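/- Let $\mathcal X_1,\mathcal X_2$ be finite sets and let $p_{X_1X_2}$, $p_{K_1K_2}$ be probability distributions on $\mathcal X_1\times\mathcal X_2$, that of the sources and that of the keys. For every $n$ let $(X_1^n,X_2^n)$ and $(K_1^n,K_2^n)$ be independent of each other, each consisting of $n$ i.i.d. pairs drawn from $p_{X_1X_2}$ and $p_{K_1K_2}$ respectively. Logarithms are to base $2$; $H$ is Shannon entropy and $I$ mutual information. A distributed source encryption system of block length $n$ consists of finite ciphertext sets $\mathcal C_1^{(n)},\mathcal C_2^{(n)}$, encryption functions $\Phi_i^{(n)}:\mathcal X_i^n\times\mathcal X_i^n\to\mathcal C_i^{(n)}$, with $C_i^{(n)}=\Phi_i^{(n)}(K_i^n,X_i^n)$, $i=1,2$, and a decryption function $\Psi^{(n)}:\mathcal X_1^n\times\mathcal X_2^n\times\mathcal C_1^{(n)}\times\mathcal C_2^{(n)}\to\mathcal X_1^n\times\mathcal X_2^n$ such that, whenever $c_i=\Phi_i^{(n)}(k_i,x_i)$ for $i=1,2$, the output $(\hat x_1,\hat x_2)=\Psi^{(n)}(k_1,k_2,c_1,c_2)$ satisfies $\Phi_i^{(n)}(k_i,\hat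 x_i)=c_i$ for $i=1,2$. It is required that there be maps $\phi_i^{(n)}:\mathcal X_i^n\to\mathcal M_i^{(n)}$ into finite sets and $\psi^{(n)}:\mathcal M_1^{(n)}\times\mathcal M_2^{(n)}\to\mathcal X_1^n\times\mathcal X_2^n$ with $$\Psi^{(n)}\bigl(k_1,k_2,\Phi_1^{(n)}(k_1,x_1),\Phi_2^{(n)}(k_2,x_2)\bigr)=\psi^{(n)}\bigl(\phi_1^{(n)}(x_1),\phi_2^{(n)}(x_2)\bigr)\quad\text{for all }k_1,k_2,x_1,x_2.$$ Its error probability is $p_{\rm e}=\Pr[\psi^{(n)}(\phi_1^{(n)}(X_1^n),\phi_2^{(n)}(X_2^n))\ne(X_1^n,X_2^n)]$. Fix $\delta_0>0$. For $\varepsilon\in(0,1)$ and $\delta\in(0,\delta_0]$ let $\mathcal R^*(\varepsilon,\delta|p_{X_1X_2},p_{K_1K_2})$ be the set of pairs $(R_1,R_2)$ of real numbers for which there is a sequence of such systems (one for each $n$) such that for every $\gamma>0$ and all sufficiently large $n$, $$\tfrac1n\log|\mathcal C_i^{(n)}|\le R_i+\gamma\ (i=1,2),\qquad p_{\rm e}\le\varepsilon,\qquad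 I(C_1^{(n)}C_2^{(n)};X_1^nX_2^n)\le\delta,$$ and let $\mathcal R^*(p_{X_1X_2},p_{K_1K_2})$ be the intersection of these sets over all $(\varepsilon,\delta)\in(0,1)\times(0,\delta_0]$. Let $$\mathcal R_{\rm sw}=\{(R_1,R_2):R_1\ge H(X_1|X_2),\ R_2\ge H(X_2|X_1),\ R_1+R_2\ge H(X_1X_2)\},$$ $$\mathcal R_{\rm key}=\{(R_1,R_2):R_1\le H(K_1),\ R_2\le H(K_2),\ R_1+R_2\le H(K_1K_2)\},$$ and let $\mathcal R(p_{X_1X_2},p_{K_1K_2})$ be the set of all $(R_1,R_2)$ such that $R_1\ge\tilde R_1$ and $R_2\ge\tilde R_2$ for some $(\tilde R_1,\tilde R_2)\in\mathcal R_{\rm key}\cap\mathcal R_{\rm sw}$. Theorem. For each $(\varepsilon,\delta)\in(0,1)\times(0,\delta_0]$, $$\mathcal R(p_{X_1X_2},p_{K_1K_2})\subseteq\mathcal R^*(p_{X_1X_2},p_{K_1K_2})\subseteq\mathcal R^*(\varepsilon,\delta|p_{X_1X_2},p_{K_1K_2}),$$ where for the first inclusion it is assumed that none of the three equalities $H(X_1|X_2)=H(K_1)$,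 $H(X_2|X_1)=H(K_2)$, $H(X_1X_2)=H(K_1K_2)$ holds with a nonzero common value. -/

import Mathlib

noncomputable section

namespace DistEnc

open scoped Classical in
/-- The law of the random variable `f` on the finite probability space with weights `p`. -/
def law {Ω α : Type*} [Fintype Ω] (p : Ω → ℝ) (f : Ω → α) : α → ℝ :=
  fun a => ∑ ω, if f ω = a then p ω else 0

/-- Shannon entropy, in bits, of a distribution on a finite set. -/
def entropy {α : Type*} [Fintype α] (p : α → ℝ) : ℝ :=
  -∑ a, p a * Real.logb 2 (p a)

/-- Conditional entropy `H(U|V)`, in bits, of a joint distribution `p` of `(U, V)`.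
Terms with `p (u, v) = 0` vanish. -/
def condEntropy {α β : Type*} [Fintype α] [Fintype β] (p : α × β → ℝ) : ℝ :=
  -∑ u, ∑ v, p (u, v) * Real.logb 2 (p (u, v) / law p Prod.snd v)

/-- Mutual information `I(U;V)`, in bits, of a joint distribution `p` of `(U, V)`.
Terms with `p (u, v) = 0` vanish. -/
def mutualInfo {α β : Type*} [Fintype α] [Fintype β] (p : α × β → ℝ) : ℝ :=
  ∑ u, ∑ v, p (u, v) *
    Real.logb 2 (p (u, v) / (law p Prod.fst u * law p Prod.snd v))

/-- The distribution of the first component of a pair. -/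
def marg₁ {A B : Type*} [Fintype A] [Fintype B] (p : A × B → ℝ) : A → ℝ := law p Prod.fst

/-- The distribution of the second component of a pair. -/
def marg₂ {A B : Type*} [Fintype A] [Fintype B] (p : A × B → ℝ) : B → ℝ := law p Prod.snd

/-- The `n`-fold memoryless extension of `p`, evaluated at a pair of strings. -/
def iidLaw {A B : Type*} (p : A × B → ℝ) (n : ℕ) : (Fin n → A) × (Fin n → B) → ℝ :=
  fun x => ∏ t, p (x.1 t, x.2 t)

/-- A distributed source code (without encryption) of block length `n`. -/
structure SourceCode (A B : Type*) (n : ℕ) where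
  /-- sizes of the two message sets -/
  m₁ : ℕ
  m₂ : ℕ
  /-- encoders -/
  φ₁ : (Fin n → A) → Fin m₁
  φ₂ : (Fin n → B) → Fin m₂
  /-- decoder -/
  ψ : Fin m₁ → Fin m₂ → (Fin n → A) × (Fin n → B)

/-- The set of correctly decoded pairs. -/
def SourceCode.correctSet {A B : Type*} {n : ℕ} (S : SourceCode A B n) :
    Set ((Fin n → A) × (Fin n → B)) :=
  {x | S.ψ (S.φ₁ x.1) (S.φ₂ x.2) = x}

open scoped Classical in
/-- The error probability of a source code for the memoryless source `pX`. -/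
def SourceCode.errorProb {A B : Type*} [Fintype A] [Fintype B] {n : ℕ}
    (S : SourceCode A B n) (pX : A × B → ℝ) : ℝ :=
  ∑ x, if x ∈ S.correctSet then 0 else iidLaw pX n x

/-- A distributed source encryption system of block length `n`: each terminal encrypts its
source string by means of its key string (the first argument), and the sink decrypts from both
keys and both ciphertexts, its output being a pair that the two keys encrypt into the two
ciphertexts received. -/
structure EncSystem (A B : Type*) (n : ℕ) where
  /-- sizes of the two ciphertext sets -/
  c₁ : ℕ
  c₂ : ℕ
  /-- encryption functions -/
  Φ₁ : (Fin n → A) → (Fin n → A) → Fin c₁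
  Φ₂ : (Fin n → B) → (Fin n → B) → Fin c₂
  /-- decryption function -/
  Ψ : (Fin n → A) → (Fin n → B) → Fin c₁ → Fin c₂ → (Fin n → A) × (Fin n → B)
  consistent₁ : ∀ k₁ k₂ x₁ x₂,
    Φ₁ k₁ (Ψ k₁ k₂ (Φ₁ k₁ x₁) (Φ₂ k₂ x₂)).1 = Φ₁ k₁ x₁
  consistent₂ : ∀ k₁ k₂ x₁ x₂,
    Φ₂ k₂ (Ψ k₁ k₂ (Φ₁ k₁ x₁) (Φ₂ k₂ x₂)).2 = Φ₂ k₂ x₂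

/-- The overall action of the encryption system on the sources is that of the source code `S`,
whatever the keys are. -/
def EncSystem.Realizes {A B : Type*} {n : ℕ} (E : EncSystem A B n) (S : SourceCode A B n) :
    Prop :=
  ∀ k₁ k₂ x₁ x₂, E.Ψ k₁ k₂ (E.Φ₁ k₁ x₁) (E.Φ₂ k₂ x₂) = S.ψ (S.φ₁ x₁) (S.φ₂ x₂)

/-- The joint distribution of the ciphertext pair and the source pair, where the keys are
independent of the sources. -/
def EncSystem.jointLaw {A B : Type*} [Fintype A] [Fintype B] {n : ℕ} (E : EncSystem A B n)
    (pX pK : A × B → ℝ) :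
    (Fin E.c₁ × Fin E.c₂) × ((Fin n → A) × (Fin n → B)) → ℝ :=
  law (fun ω : ((Fin n → A) × (Fin n → B)) × ((Fin n → A) × (Fin n → B)) =>
      iidLaw pK n ω.1 * iidLaw pX n ω.2)
    (fun ω => ((E.Φ₁ ω.1.1 ω.2.1, E.Φ₂ ω.1.2 ω.2.2), ω.2))

/-- `I(C₁C₂; X₁X₂)`: the information on the sources leaked by the ciphertexts. -/
def EncSystem.leakage {A B : Type*} [Fintype A] [Fintype B] {n : ℕ} (E : EncSystem A B n)
    (pX pK : A × B → ℝ) : ℝ :=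
  mutualInfo (E.jointLaw pX pK)

/-- `R` is an `(ε, δ)`-reliable and secure rate pair. -/
def IsReliableSecure {A B : Type*} [Fintype A] [Fintype B] (pX pK : A × B → ℝ) (ε δ : ℝ)
    (R : ℝ × ℝ) : Prop :=
  ∃ (E : ∀ n : ℕ, EncSystem A B n) (S : ∀ n : ℕ, SourceCode A B n),
    (∀ n, (E n).Realizes (S n)) ∧
    ∀ γ : ℝ, 0 < γ → ∃ n₀ : ℕ, ∀ n ≥ n₀,
      1 / (n : ℝ) * Real.logb 2 ((E n).c₁ : ℝ) ≤ R.1 + γ ∧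
      1 / (n : ℝ) * Real.logb 2 ((E n).c₂ : ℝ) ≤ R.2 + γ ∧
      (S n).errorProb pX ≤ ε ∧
      (E n).leakage pX pK ≤ δ

/-- The `(ε, δ)`-reliable and secure rate region. -/
def regionED {A B : Type*} [Fintype A] [Fintype B] (ε δ : ℝ) (pX pK : A × B → ℝ) :
    Set (ℝ × ℝ) :=
  {R | IsReliableSecure pX pK ε δ R}

/-- The reliable and secure rate region. -/
def region {A B : Type*} [Fintype A] [Fintype B] (δ₀ : ℝ) (pX pK : A × B → ℝ) :
    Set (ℝ × ℝ) :=
  ⋂ ε ∈ Set.Ioo (0 : ℝ) 1, ⋂ δ ∈ Set.Ioc (0 : ℝ) δ₀, regionED ε δ pX pK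

/-- `H(X₁|X₂)`. -/
def H₁given₂ {A B : Type*} [Fintype A] [Fintype B] (p : A × B → ℝ) : ℝ := condEntropy p

/-- `H(X₂|X₁)`. -/
def H₂given₁ {A B : Type*} [Fintype A] [Fintype B] (p : A × B → ℝ) : ℝ :=
  condEntropy (fun y : B × A => p (y.2, y.1))

/-- The Slepian–Wolf region. -/
def regionSW {A B : Type*} [Fintype A] [Fintype B] (pX : A × B → ℝ) : Set (ℝ × ℝ) :=
  {R | H₁given₂ pX ≤ R.1 ∧ H₂given₁ pX ≤ R.2 ∧ entropy pX ≤ R.1 + R.2}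

/-- The key region. -/
def regionKey {A B : Type*} [Fintype A] [Fintype B] (pK : A × B → ℝ) : Set (ℝ × ℝ) :=
  {R | R.1 ≤ entropy (marg₁ pK) ∧ R.2 ≤ entropy (marg₂ pK) ∧ R.1 + R.2 ≤ entropy pK}

/-- The rate pairs that dominate some point of both the key and the Slepian–Wolf region. -/
def innerRegion {A B : Type*} [Fintype A] [Fintype B] (pX pK : A × B → ℝ) : Set (ℝ × ℝ) :=
  {R | ∃ R' ∈ regionKey pK ∩ regionSW pX, R'.1 ≤ R.1 ∧ R'.2 ≤ R.2}

end DistEnc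

end

namespace DistEnc

open scoped Classical Topology
open Filter

/-! ### Marginals and products -/

/-! The second inclusion only says that an intersection lies in each of its members; the work is in
the first. The system is a one-time pad on compressed strings: with `Fin m₁` and `Fin m₂` as cyclic
groups, the ciphertexts are `κᵢ kᵢ + φᵢ xᵢ`, where `φᵢ` bins the source and `κᵢ` hashes the key, and
the sink subtracts the hashed keys and decodes the bins. Binning and hashing thus share nothing but
the sizes `mᵢ = ⌊2 ^ (n rᵢ)⌋`.

Both are chosen at random, and a single exact average serves both (`sum_sum_collision`): the
expected mass of the pairs that collide with a given pair. The decoder picks a likeliest pair of the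
bin, so an error forces a colliding mass of at least `2 p x`; this yields `exists_binning_error_le`.
Jensen's inequality for `log` turns the same average into a bound on the divergence of the hashed
keys from uniformity (`exists_hash_divergence_le`), and this divergence bounds the leakage
(`mutualInfo_pad_le`).

For memoryless laws every quantity in these bounds is a product over time. If `log v` has negative
mean, then `v ^ s` has mean below 1 for some small `s > 0`, so its `n`-fold product has a mean that
decays geometrically. Hence the error and the unnormalised leakage tend to 0 as soon as each rate
constraint is strict, or degenerate in a way that makes its term vanish identically.

`exists_strict_rates` produces such rates within `γ` above a point of the intersection of the two
polygons; this is where equality with a nonzero common value must be excluded. The rates depend on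
`γ`, and `exists_diagonal` merges the resulting systems into one sequence. -/

theorem law_fst_apply {α β : Type*} [Fintype α] [Fintype β] (p : α × β → ℝ) (a : α) :
    law p Prod.fst a = ∑ b, p (a, b) := by
  simp only [law, Fintype.sum_prod_type]
  rw [Finset.sum_eq_single a] <;> simp +contextual

theorem law_snd_apply {α β : Type*} [Fintype α] [Fintype β] (p : α × β → ℝ) (b : β) :
    law p Prod.snd b = ∑ a, p (a, b) := by
  simp only [law, Fintype.sum_prod_type, Finset.sum_ite_eq', Finset.mem_univ, if_true]

theorem law_nonneg {Ω α : Type*} [Fintype Ω] {p : Ω → ℝ} (hp : ∀ ω, 0 ≤ p ω) (f : Ω → α)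
    (a : α) : 0 ≤ law p f a :=
  Finset.sum_nonneg fun ω _ => by split_ifs <;> simp [hp]

theorem le_law {Ω α : Type*} [Fintype Ω] {p : Ω → ℝ} (hp : ∀ ω, 0 ≤ p ω) (f : Ω → α)
    (ω : Ω) : p ω ≤ law p f (f ω) := by
  have := Finset.single_le_sum (f := fun ω' => if f ω' = f ω then p ω' else 0)
    (fun i _ => by split_ifs <;> simp [hp]) (Finset.mem_univ ω)
  simpa [law] using this

theorem sum_law_mul {Ω α : Type*} [Fintype Ω] [Fintype α] (p : Ω → ℝ) (f : Ω → α) (g : α → ℝ) :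
    ∑ a, law p f a * g a = ∑ ω, p ω * g (f ω) := by
  simp only [law, Finset.sum_mul]
  rw [Finset.sum_comm]
  simp [ite_mul]

theorem sum_law {Ω α : Type*} [Fintype Ω] [Fintype α] (p : Ω → ℝ) (f : Ω → α) :
    ∑ a, law p f a = ∑ ω, p ω := by
  simpa using sum_law_mul p f (fun _ => 1)

theorem law_mem_stdSimplex {Ω α : Type*} [Fintype Ω] [Fintype α] {p : Ω → ℝ}
    (hp : p ∈ stdSimplex ℝ Ω) (f : Ω → α) : law p f ∈ stdSimplex ℝ α :=
  ⟨law_nonneg hp.1 f, by rw [sum_law, hp.2]⟩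

theorem sum_prod_pair {A B : Type*} [Fintype A] [Fintype B] (g : A × B → ℝ) (n : ℕ) :
    ∑ x : (Fin n → A) × (Fin n → B), ∏ t, g (x.1 t, x.2 t) = (∑ z, g z) ^ n := by
  rw [Fintype.sum_pow]
  exact ((Equiv.arrowProdEquivProdArrow (Fin n) (fun _ => A) (fun _ => B)).symm.sum_comp
    (fun z : Fin n → A × B => ∏ t, g (z t)))

theorem iidLaw_mem_stdSimplex {A B : Type*} [Fintype A] [Fintype B] {p : A × B → ℝ}
    (hp : p ∈ stdSimplex ℝ (A × B)) (n : ℕ) :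
    iidLaw p n ∈ stdSimplex ℝ ((Fin n → A) × (Fin n → B)) :=
  ⟨fun _ => Finset.prod_nonneg fun _ _ => hp.1 _, by
    simp only [iidLaw]; rw [sum_prod_pair, hp.2, one_pow]⟩

theorem law_fst_iidLaw {A B : Type*} [Fintype A] [Fintype B] (p : A × B → ℝ) (n : ℕ)
    (x : Fin n → A) : law (iidLaw p n) Prod.fst x = ∏ t, law p Prod.fst (x t) := by
  simp only [law_fst_apply, iidLaw]
  rw [Finset.prod_univ_sum, Fintype.piFinset_univ]

theorem law_snd_iidLaw {A B : Type*} [Fintype A] [Fintype B] (p : A × B → ℝ) (n : ℕ)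
    (y : Fin n → B) : law (iidLaw p n) Prod.snd y = ∏ t, law p Prod.snd (y t) := by
  simp only [law_snd_apply, iidLaw]
  rw [Finset.prod_univ_sum, Fintype.piFinset_univ]

/-! ### Random hashing -/

/-- For `x ≠ x'`, translating the value at `x` by `d` permutes the functions, so all values of `f x'
- f x` are equally frequent. -/
theorem sum_ite_apply_eq_apply {X G : Type*} [Fintype X] [Fintype G] [AddCommGroup G] (x x' : X) :
    (∑ f : X → G, if f x = f x' then (1 : ℝ) else 0) * Fintype.card G =
      Fintype.card (X → G) * (1 + (Fintype.card G - 1) * if x = x' then 1 else 0) := by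
  by_cases h : x = x'
  · subst h; simp
  · have key : ∀ d : G, (∑ f : X → G, if f x = f x' then (1 : ℝ) else 0) =
        ∑ f : X → G, if d = f x' - f x then (1 : ℝ) else 0 := fun d => by
      rw [← Equiv.sum_comp (Equiv.addRight (Pi.single x d : X → G))]
      refine Finset.sum_congr rfl fun f _ => ?_
      have : (Pi.single x d : X → G) x' = 0 := by simp [Ne.symm h]
      simp [this, eq_sub_iff_add_eq']
    have : (Fintype.card G : ℝ) * (∑ f : X → G, if f x = f x' then (1 : ℝ) else 0) =
        Fintype.card (X → G) := by
      rw [← nsmul_eq_mul, ← Finset.card_univ, ← Finset.sum_const,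
        Finset.sum_congr rfl fun d _ => key d, Finset.sum_comm]
      simp
    rw [mul_comm, this]; simp [h]

theorem sum_ite_map_eq_map {X Y G H : Type*} [Fintype X] [Fintype Y] [Fintype G] [AddCommGroup G]
    [Fintype H] [AddCommGroup H] (x x' : X × Y) :
    (∑ f : (X → G) × (Y → H), if Prod.map f.1 f.2 x = Prod.map f.1 f.2 x' then (1 : ℝ) else 0) *
        (Fintype.card G * Fintype.card H) =
      Fintype.card ((X → G) × (Y → H)) *
        ((1 + (Fintype.card G - 1) * if x.1 = x'.1 then 1 else 0) *
          (1 + (Fintype.card H - 1) * if x.2 = x'.2 then 1 else 0)) := by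
  have h1 := sum_ite_apply_eq_apply (G := G) x.1 x'.1
  have h2 := sum_ite_apply_eq_apply (G := H) x.2 x'.2
  have h3 : (∑ f : (X → G) × (Y → H),
      if Prod.map f.1 f.2 x = Prod.map f.1 f.2 x' then (1 : ℝ) else 0) =
      (∑ f : X → G, if f x.1 = f x'.1 then (1 : ℝ) else 0) *
        ∑ f : Y → H, if f x.2 = f x'.2 then (1 : ℝ) else 0 := by
    rw [Finset.sum_mul_sum, Fintype.sum_prod_type]
    refine Finset.sum_congr rfl fun f _ => Finset.sum_congr rfl fun g _ => ?_
    by_cases a : f x.1 = f x'.1 <;> by_cases b : g x.2 = g x'.2 <;>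
      simp [Prod.map, a, b]
  rw [h3, mul_mul_mul_comm, h1, h2, Fintype.card_prod, Nat.cast_mul]
  ring

theorem sum_mul_collision {X Y : Type*} [Fintype X] [Fintype Y] (p : X × Y → ℝ) (a b : ℝ)
    (x : X × Y) :
    ∑ x', p x' * ((1 + a * if x.1 = x'.1 then 1 else 0) *
        (1 + b * if x.2 = x'.2 then 1 else 0)) =
      ∑ x', p x' + a * law p Prod.fst x.1 + b * law p Prod.snd x.2 + a * b * p x := by
  have h : p x = ∑ x', if x' = x then p x' else 0 := by simp
  rw [h]
  simp only [law, Finset.mul_sum, ← Finset.sum_add_distrib]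
  refine Finset.sum_congr rfl fun x' _ => ?_
  by_cases h1 : x'.1 = x.1 <;> by_cases h2 : x'.2 = x.2 <;>
    simp [h1, h2, Prod.ext_iff, eq_comm (a := x.1), eq_comm (a := x.2)] <;> ring

/-- Averaging over random functions: the mean of a collision count. -/
theorem sum_sum_collision {X Y G H : Type*} [Fintype X] [Fintype Y] [Fintype G] [AddCommGroup G]
    [Fintype H] [AddCommGroup H] (p : X × Y → ℝ) (x : X × Y) :
    (Fintype.card G * Fintype.card H : ℝ) * ∑ f : (X → G) × (Y → H),
        law p (Prod.map f.1 f.2) (Prod.map f.1 f.2 x) =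
      Fintype.card ((X → G) × (Y → H)) * (∑ x', p x' +
        (Fintype.card G - 1) * law p Prod.fst x.1 + (Fintype.card H - 1) * law p Prod.snd x.2 +
        (Fintype.card G - 1) * (Fintype.card H - 1) * p x) := by
  rw [← sum_mul_collision]
  simp only [law]
  rw [Finset.sum_comm, Finset.mul_sum, Finset.mul_sum]
  refine Finset.sum_congr rfl fun x' _ => ?_
  rw [mul_left_comm _ (p x'), ← sum_ite_map_eq_map (G := G) (H := H) x x', ← mul_assoc,
    mul_comm _ (_ * _ : ℝ), mul_left_comm, Finset.mul_sum, Finset.mul_sum, Finset.mul_sum]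
  refine Finset.sum_congr rfl fun f _ => ?_
  simp only [eq_comm (a := Prod.map f.1 f.2 x'), mul_ite, mul_one, mul_zero]
  split_ifs <;> ring

theorem exists_le_of_average_le {Ω : Type*} [Fintype Ω] [Nonempty Ω] (F : Ω → ℝ) (B : ℝ)
    (h : ∑ ω, F ω ≤ Fintype.card Ω * B) : ∃ ω, F ω ≤ B := by
  obtain ⟨ω, -, h⟩ := Finset.exists_le_of_sum_le (s := Finset.univ) (f := F) (g := fun _ => B)
    Finset.univ_nonempty (by simpa using h)
  exact ⟨ω, h⟩

/-- Random hashing of a pair of keys: some pair of hash functions has nearly uniform output. -/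
theorem exists_hash_divergence_le {X Y G H : Type*} [Fintype X] [Fintype Y] [Fintype G]
    [AddCommGroup G] [Fintype H] [AddCommGroup H] {q : X × Y → ℝ}
    (hq : q ∈ stdSimplex ℝ (X × Y)) :
    ∃ (f : X → G) (g : Y → H),
      ∑ s, law q (Prod.map f g) s *
          Real.log (Fintype.card G * Fintype.card H * law q (Prod.map f g) s) ≤
        ∑ k, q k * Real.log (1 + (Fintype.card G - 1) * law q Prod.fst k.1 +
          (Fintype.card H - 1) * law q Prod.snd k.2 +
          (Fintype.card G - 1) * (Fintype.card H - 1) * q k) := by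
  have hG : (1 : ℝ) ≤ Fintype.card G := by exact_mod_cast Fintype.card_pos
  have hH : (1 : ℝ) ≤ Fintype.card H := by exact_mod_cast Fintype.card_pos
  have average := exists_le_of_average_le
    (fun f : (X → G) × (Y → H) => ∑ s, law q (Prod.map f.1 f.2) s *
      Real.log (Fintype.card G * Fintype.card H * law q (Prod.map f.1 f.2) s))
    (∑ k, q k * Real.log (1 + (Fintype.card G - 1) * law q Prod.fst k.1 +
          (Fintype.card H - 1) * law q Prod.snd k.2 +
          (Fintype.card G - 1) * (Fintype.card H - 1) * q k))
  refine (fun ⟨⟨f, g⟩, h⟩ => ⟨f, g, h⟩) (average ?_)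
  simp only [sum_law_mul]
  rw [Finset.sum_comm, Finset.mul_sum]
  refine Finset.sum_le_sum fun k _ => ?_
  rw [← Finset.mul_sum, mul_left_comm]
  rcases (hq.1 k).eq_or_lt with h0 | h0
  · simp [← h0]
  refine mul_le_mul_of_nonneg_left ?_ h0.le
  set c : ℝ := 1 + (Fintype.card G - 1) * law q Prod.fst k.1 +
          (Fintype.card H - 1) * law q Prod.snd k.2 +
          (Fintype.card G - 1) * (Fintype.card H - 1) * q k with hc
  have hc0 : 0 < c := by
    have h1 := mul_nonneg (sub_nonneg.2 hG) (law_nonneg hq.1 Prod.fst k.1)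
    have h2 := mul_nonneg (sub_nonneg.2 hH) (law_nonneg hq.1 Prod.snd k.2)
    have h3 := mul_nonneg (mul_nonneg (sub_nonneg.2 hG) (sub_nonneg.2 hH)) h0.le
    linarith
  have avg := sum_sum_collision (G := G) (H := H) q k
  rw [hq.2, ← hc] at avg
  -- Jensen's inequality by the tangent of `log` at `c`. By `avg`, `c` is the mean over the hash
  -- functions of the argument of `log`, so the linear corrections sum to 0.
  have tangent : ∀ f : (X → G) × (Y → H),
      Real.log (Fintype.card G * Fintype.card H * law q (Prod.map f.1 f.2) (Prod.map f.1 f.2 k)) ≤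
        Real.log c + (Fintype.card G * Fintype.card H *
          law q (Prod.map f.1 f.2) (Prod.map f.1 f.2 k) / c - 1) := fun f => by
    have hpos : 0 < Fintype.card G * Fintype.card H *
        law q (Prod.map f.1 f.2) (Prod.map f.1 f.2 k) :=
      mul_pos (by positivity) (h0.trans_le (le_law hq.1 _ k))
    have := Real.log_le_sub_one_of_pos (div_pos hpos hc0)
    rw [Real.log_div hpos.ne' hc0.ne'] at this
    linarith
  refine (Finset.sum_le_sum fun f _ => tangent f).trans_eq ?_
  rw [Finset.sum_add_distrib, Finset.sum_sub_distrib, ← Finset.sum_div, ← Finset.mul_sum, avg,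
    mul_div_assoc, div_self hc0.ne']
  simp

/-- Random binning of a pair of sources, with the most likely element of a bin as the estimate. -/
theorem exists_binning_error_le {X Y G H : Type*} [Fintype X] [Fintype Y] [Fintype G]
    [AddCommGroup G] [Fintype H] [AddCommGroup H] {p : X × Y → ℝ}
    (hp : p ∈ stdSimplex ℝ (X × Y)) :
    ∃ (f : X → G) (g : Y → H) (ψ : G → H → X × Y),
      (∀ x, Prod.map f g (ψ (f x.1) (g x.2)) = Prod.map f g x) ∧
      ∑ x, (if ψ (f x.1) (g x.2) = x then 0 else p x) ≤
        ∑ x, p x * (min 1 ((law p Prod.snd x.2 / p x - 1) / Fintype.card G) +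
          min 1 ((law p Prod.fst x.1 / p x - 1) / Fintype.card H) +
          min 1 ((1 / p x - 1) / (Fintype.card G * Fintype.card H))) := by
  have hG : (1 : ℝ) ≤ Fintype.card G := by exact_mod_cast Fintype.card_pos
  have hH : (1 : ℝ) ≤ Fintype.card H := by exact_mod_cast Fintype.card_pos
  have hne : Nonempty (X × Y) := by
    by_contra h
    rw [not_nonempty_iff] at h
    simpa using hp.2
  -- A maximum-likelihood decoder. Its output stays in the received bins, which later gives the
  -- consistency of the decryption.
  have dec : ∀ f : (X → G) × (Y → H), ∃ ψ : G → H → X × Y, ∀ x,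
      Prod.map f.1 f.2 (ψ (f.1 x.1) (f.2 x.2)) = Prod.map f.1 f.2 x ∧
      p x ≤ p (ψ (f.1 x.1) (f.2 x.2)) := fun f => by
    have : ∀ c : G × H, ∃ z, ∀ x, Prod.map f.1 f.2 x = c → Prod.map f.1 f.2 z = c ∧ p x ≤ p z := by
      intro c
      by_cases hc : (Finset.univ.filter fun x => Prod.map f.1 f.2 x = c).Nonempty
      · obtain ⟨z, hz, hmax⟩ := Finset.exists_max_image _ p hc
        exact ⟨z, fun x hx => ⟨(Finset.mem_filter.1 hz).2, hmax x (by simp [hx])⟩⟩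
      · obtain ⟨z⟩ := hne
        exact ⟨z, fun x hx => (hc ⟨x, by simp [hx]⟩).elim⟩
    choose z hz using this
    exact ⟨fun a b => z (a, b), fun x => hz _ x rfl⟩
  choose ψ hψ using dec
  have average := exists_le_of_average_le
    (fun f : (X → G) × (Y → H) => ∑ x, (if ψ f (f.1 x.1) (f.2 x.2) = x then 0 else p x))
    (∑ x, p x * (min 1 ((law p Prod.snd x.2 / p x - 1) / Fintype.card G) +
          min 1 ((law p Prod.fst x.1 / p x - 1) / Fintype.card H) +
          min 1 ((1 / p x - 1) / (Fintype.card G * Fintype.card H))))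
  refine (fun ⟨f, h⟩ => ⟨f.1, f.2, ψ f, fun x => (hψ f x).1, h⟩) (average ?_)
  rw [Finset.sum_comm, Finset.mul_sum]
  refine Finset.sum_le_sum fun x _ => ?_
  rcases (hp.1 x).eq_or_lt with h0 | h0
  · simp [← h0]
  have e : ∀ f : (X → G) × (Y → H), (if ψ f (f.1 x.1) (f.2 x.2) = x then 0 else p x) =
      p x * (if ψ f (f.1 x.1) (f.2 x.2) = x then 0 else 1) := fun f => by simp
  rw [Finset.sum_congr rfl fun f _ => e f, ← Finset.mul_sum, mul_left_comm]
  refine mul_le_mul_of_nonneg_left ?_ h0.le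
  have avg := sum_sum_collision (G := G) (H := H) p x
  rw [hp.2] at avg
  -- After an error the bin contains, besides `x`, a different pair at least as likely, so its mass
  -- is at least `2 * p x`.
  have point : ∀ f : (X → G) × (Y → H), (if ψ f (f.1 x.1) (f.2 x.2) = x then (0 : ℝ) else 1) ≤
      law p (Prod.map f.1 f.2) (Prod.map f.1 f.2 x) / p x - 1 := fun f => by
    rw [le_sub_iff_add_le, le_div_iff₀ h0]
    split_ifs with hx
    · simpa using le_law hp.1 (Prod.map f.1 f.2) x
    · have h2 : ∑ z ∈ {x, ψ f (f.1 x.1) (f.2 x.2)},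
          (if Prod.map f.1 f.2 z = Prod.map f.1 f.2 x then p z else 0) ≤
            ∑ z, (if Prod.map f.1 f.2 z = Prod.map f.1 f.2 x then p z else 0) :=
        Finset.sum_le_sum_of_subset_of_nonneg (Finset.subset_univ _)
          fun z _ _ => by split_ifs <;> simp [hp.1]
      rw [Finset.sum_pair (Ne.symm hx), if_pos rfl, if_pos (hψ f x).1] at h2
      have h3 : law p (Prod.map f.1 f.2) (Prod.map f.1 f.2 x) =
          ∑ z, (if Prod.map f.1 f.2 z = Prod.map f.1 f.2 x then p z else 0) := by
        unfold law; congr!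
      linarith [(hψ f x).2]
  set N : ℝ := (Fintype.card ((X → G) × (Y → H)) : ℝ) with hN
  have hN0 : 0 < N := by rw [hN]; exact_mod_cast Fintype.card_pos
  have hp1 := le_law hp.1 Prod.fst x
  have hp2 := le_law hp.1 Prod.snd x
  have hp3 : p x ≤ 1 := hp.2 ▸ Finset.single_le_sum (fun i _ => hp.1 i) (Finset.mem_univ x)
  set m₁ : ℝ := (Fintype.card G : ℝ)
  set m₂ : ℝ := (Fintype.card H : ℝ)
  -- The subtracted 1 matters: these excesses vanish, rather than merely stay bounded, when the
  -- corresponding entropy is 0.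
  set u₁ : ℝ := law p Prod.snd x.2 / p x - 1 with hu1
  set u₂ : ℝ := law p Prod.fst x.1 / p x - 1 with hu2
  set u₃ : ℝ := 1 / p x - 1 with hu3
  have n1 : 0 ≤ u₁ := by rw [hu1, sub_nonneg, le_div_iff₀ h0]; simpa using hp2
  have n2 : 0 ≤ u₂ := by rw [hu2, sub_nonneg, le_div_iff₀ h0]; simpa using hp1
  have n3 : 0 ≤ u₃ := by rw [hu3, sub_nonneg, le_div_iff₀ h0]; simpa using hp3
  have bound : ∑ f : (X → G) × (Y → H), (if ψ f (f.1 x.1) (f.2 x.2) = x then (0 : ℝ) else 1) ≤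
      N * (u₁ / m₁ + u₂ / m₂ + u₃ / (m₁ * m₂)) := by
    refine (Finset.sum_le_sum fun f _ => point f).trans ?_
    rw [Finset.sum_sub_distrib, ← Finset.sum_div, Finset.sum_const, Finset.card_univ, nsmul_eq_mul,
      mul_one, ← hN]
    have : ∑ f : (X → G) × (Y → H), law p (Prod.map f.1 f.2) (Prod.map f.1 f.2 x) =
        N * (1 + (m₁ - 1) * law p Prod.fst x.1 + (m₂ - 1) * law p Prod.snd x.2 +
        (m₁ - 1) * (m₂ - 1) * p x) / (m₁ * m₂) := by
      rw [eq_div_iff (by positivity), ← avg, mul_comm]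
    rw [this]
    have e1 : law p Prod.snd x.2 = (u₁ + 1) * p x := by rw [hu1]; field_simp; ring
    have e2 : law p Prod.fst x.1 = (u₂ + 1) * p x := by rw [hu2]; field_simp; ring
    have e3 : (1 : ℝ) = (u₃ + 1) * p x := by rw [hu3]; field_simp; ring
    have e4 : N * (1 + (m₁ - 1) * law p Prod.fst x.1 + (m₂ - 1) * law p Prod.snd x.2 +
        (m₁ - 1) * (m₂ - 1) * p x) / (m₁ * m₂) / p x - N =
        N * ((u₃ + (m₁ - 1) * u₂ + (m₂ - 1) * u₁) / (m₁ * m₂)) := by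
      rw [e1, e2]
      nth_rewrite 1 [e3]
      field_simp
      ring
    rw [e4]
    refine mul_le_mul_of_nonneg_left ?_ hN0.le
    have e5 : u₁ / m₁ + u₂ / m₂ + u₃ / (m₁ * m₂) = (u₃ + m₁ * u₂ + m₂ * u₁) / (m₁ * m₂) := by
      field_simp; ring
    rw [e5]
    gcongr <;> linarith
  have bound' : ∑ f : (X → G) × (Y → H), (if ψ f (f.1 x.1) (f.2 x.2) = x then (0 : ℝ) else 1) ≤
      N * 1 := by
    rw [mul_one, hN, ← Finset.card_univ, ← nsmul_one, ← Finset.sum_const]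
    exact Finset.sum_le_sum fun f _ => by split_ifs <;> simp
  -- Capping each term separately lets each have its own exponent `s` later.
  have hmin : min 1 (u₁ / m₁ + u₂ / m₂ + u₃ / (m₁ * m₂)) ≤
      min 1 (u₁ / m₁) + min 1 (u₂ / m₂) + min 1 (u₃ / (m₁ * m₂)) := by
    have a1 : 0 ≤ u₁ / m₁ := by positivity
    have a2 : 0 ≤ u₂ / m₂ := by positivity
    have a3 : 0 ≤ u₃ / (m₁ * m₂) := by positivity
    grind
  calc _ ≤ N * min 1 (u₁ / m₁ + u₂ / m₂ + u₃ / (m₁ * m₂)) := by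
        rw [mul_min_of_nonneg _ _ hN0.le]; exact le_min bound' bound
    _ ≤ _ := mul_le_mul_of_nonneg_left hmin hN0.le

/-! ### Exponential bounds for memoryless sources -/

/-- As a function of `s` the sum equals 1 at 0, where its derivative is the mean of `log v`. The
bound `s ≤ 1` is kept because it makes `y ↦ y ^ s` subadditive, and at least `y` on `[0, 1]`. -/
theorem exists_sum_mul_rpow_lt_one {Z : Type*} [Fintype Z] {p v : Z → ℝ}
    (hp : p ∈ stdSimplex ℝ Z) (hv : ∀ z, 0 < p z → 0 < v z)
    (h : ∑ z, p z * Real.log (v z) < 0) :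
    ∃ s : ℝ, 0 < s ∧ s ≤ 1 ∧ ∑ z, p z * v z ^ s < 1 := by
  have hd : HasDerivAt (fun s : ℝ => ∑ z, p z * v z ^ s) (∑ z, p z * Real.log (v z)) 0 := by
    refine HasDerivAt.fun_sum fun z _ => ?_
    rcases (hp.1 z).eq_or_lt with h0 | h0
    · simpa [← h0] using hasDerivAt_const (0 : ℝ) (0 : ℝ)
    · simpa using ((hasDerivAt_id (0 : ℝ)).const_rpow (hv z h0)).const_mul (p z)
  have hslope := (hasDerivAt_iff_tendsto_slope.1 hd).mono_left
    (nhdsWithin_mono 0 (s := Set.Ioi 0) fun x (hx : 0 < x) => hx.ne')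
  have h1 : ∀ᶠ s : ℝ in 𝓝[>] 0, s ≤ 1 :=
    (eventually_le_nhds one_pos).filter_mono nhdsWithin_le_nhds
  obtain ⟨s, hs, hs1, hs0⟩ :=
    ((hslope.eventually_lt_const h).and (h1.and self_mem_nhdsWithin)).exists
  refine ⟨s, hs0, hs1, ?_⟩
  have hs0' : (0 : ℝ) < s := hs0
  rw [slope_def_field, div_lt_iff₀ (by simpa using hs0')] at hs
  simp only [Real.rpow_zero, mul_one, hp.2, zero_mul] at hs
  linarith

theorem sum_iidLaw_mul_prod_rpow {A B : Type*} [Fintype A] [Fintype B] (p : A × B → ℝ)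
    {v : A × B → ℝ} (hv : ∀ z, 0 ≤ v z) (s : ℝ) (n : ℕ) :
    ∑ x, iidLaw p n x * (∏ t, v (x.1 t, x.2 t)) ^ s = (∑ z, p z * v z ^ s) ^ n := by
  rw [← sum_prod_pair]
  refine Finset.sum_congr rfl fun x _ => ?_
  rw [Finset.prod_mul_distrib, Real.finsetProd_rpow _ _ fun _ _ => hv _]
  rfl

theorem tendsto_sum_iidLaw_mul_rpow {A B : Type*} [Fintype A] [Fintype B] {p v : A × B → ℝ}
    (hp : p ∈ stdSimplex ℝ (A × B)) (hv : ∀ z, 0 ≤ v z) (hv' : ∀ z, 0 < p z → 0 < v z)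
    (h : ∑ z, p z * Real.log (v z) < 0) :
    ∃ s : ℝ, 0 < s ∧ s ≤ 1 ∧
      Tendsto (fun n => ∑ x, iidLaw p n x * (∏ t, v (x.1 t, x.2 t)) ^ s) atTop (𝓝 0) := by
  obtain ⟨s, hs0, hs1, hs⟩ := exists_sum_mul_rpow_lt_one hp hv' h
  refine ⟨s, hs0, hs1, ?_⟩
  simp only [sum_iidLaw_mul_prod_rpow p hv]
  exact tendsto_pow_atTop_nhds_zero_of_lt_one
    (Finset.sum_nonneg fun z _ => mul_nonneg (hp.1 z) (Real.rpow_nonneg (hv z) s)) hs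

theorem sum_mul_log_mul_rpow {Z : Type*} [Fintype Z] {p w : Z → ℝ} (hp : p ∈ stdSimplex ℝ Z)
    (hw : ∀ z, 0 < p z → 0 < w z) (r : ℝ) :
    ∑ z, p z * Real.log (w z * 2 ^ r) = ∑ z, p z * Real.log (w z) + r * Real.log 2 := by
  have : r * Real.log 2 = ∑ z, p z * (r * Real.log 2) := by rw [← Finset.sum_mul, hp.2, one_mul]
  rw [this, ← Finset.sum_add_distrib]
  refine Finset.sum_congr rfl fun z _ => ?_
  rcases (hp.1 z).eq_or_lt with h0 | h0
  · simp [← h0]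
  · rw [Real.log_mul (hw z h0).ne' (by positivity), Real.log_rpow two_pos]; ring

theorem prod_mul_rpow_two {A B : Type*} {n : ℕ} (w : A × B → ℝ) (r : ℝ)
    (x : (Fin n → A) × (Fin n → B)) :
    ∏ t, (w (x.1 t, x.2 t) * 2 ^ r) = (∏ t, w (x.1 t, x.2 t)) * 2 ^ (n * r) := by
  rw [Finset.prod_mul_distrib, Finset.prod_const, Finset.card_univ, Fintype.card_fin,
    ← Real.rpow_natCast, ← Real.rpow_mul two_pos.le, mul_comm r]

/-- Binning at rate `r` above the mean of `log w` makes the list of size `∏ w` rarely ambiguous. -/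
theorem eventually_sum_iidLaw_mul_min_le {A B : Type*} [Fintype A] [Fintype B] {p w : A × B → ℝ}
    (hp : p ∈ stdSimplex ℝ (A × B)) (hw : ∀ z, 0 ≤ w z) (hw' : ∀ z, 0 < p z → 0 < w z)
    {r c : ℝ} (hc : 0 ≤ c) {m : ℕ → ℝ} (hm : ∀ n : ℕ, 0 < m n)
    (hm' : ∀ n : ℕ, (2 : ℝ) ^ (n * r) ≤ c * m n)
    (h : ∑ z, p z * Real.log (w z) < r * Real.log 2 ∨ ∀ z, 0 < p z → w z = 1)
    {η : ℝ} (hη : 0 < η) :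
    ∀ᶠ n in atTop, ∑ x, iidLaw p n x * min 1 (((∏ t, w (x.1 t, x.2 t)) - 1) / m n) ≤ η := by
  rcases h with h | h
  · have h' : ∑ z, p z * Real.log (w z * 2 ^ (-r)) < 0 := by
      rw [sum_mul_log_mul_rpow hp hw']; linarith
    obtain ⟨s, hs0, hs1, hs⟩ := tendsto_sum_iidLaw_mul_rpow hp
      (fun z => mul_nonneg (hw z) (by positivity))
      (fun z hz => mul_pos (hw' z hz) (by positivity)) h'
    have hs' := hs.const_mul (c ^ s)
    rw [mul_zero] at hs'
    filter_upwards [hs'.eventually_le_const hη] with n hn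
    refine le_trans ?_ hn
    rw [Finset.mul_sum]
    refine Finset.sum_le_sum fun x _ => ?_
    rw [mul_left_comm]
    refine mul_le_mul_of_nonneg_left ?_ ((iidLaw_mem_stdSimplex hp n).1 x)
    rw [prod_mul_rpow_two]
    set W := ∏ t, w (x.1 t, x.2 t)
    have hW : 0 ≤ W := Finset.prod_nonneg fun _ _ => hw _
    -- The Chernoff step: `min 1 y ≤ y ^ s` for `0 ≤ y` and `0 < s ≤ 1`.
    have h1 : min 1 ((W - 1) / m n) ≤ (W / m n) ^ s := by
      rcases le_total 1 (W / m n) with h1 | h1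
      · exact (min_le_left _ _).trans (Real.one_le_rpow h1 hs0.le)
      · refine (min_le_right _ _).trans (le_trans ?_
          (Real.self_le_rpow_of_le_one (div_nonneg hW (hm n).le) h1 hs1))
        exact div_le_div_of_nonneg_right (by linarith) (hm n).le
    refine h1.trans ?_
    rw [← Real.mul_rpow hc (mul_nonneg hW (by positivity))]
    refine Real.rpow_le_rpow (div_nonneg hW (hm n).le) ?_ hs0.le
    rw [div_le_iff₀ (hm n), mul_neg, Real.rpow_neg two_pos.le]
    have h2 : 0 < (2 : ℝ) ^ (n * r) := by positivity
    calc W = W * ((2 : ℝ) ^ (n * r))⁻¹ * 2 ^ (n * r) := by field_simp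
      _ ≤ W * ((2 : ℝ) ^ (n * r))⁻¹ * (c * m n) :=
        mul_le_mul_of_nonneg_left (hm' n) (mul_nonneg hW (by positivity))
      _ = _ := by ring
  -- Degenerate case: on every string pair of positive probability the product is exactly 1, so each
  -- summand is 0 or negative whatever the rate.
  · refine Eventually.of_forall fun n => le_trans (Finset.sum_nonpos fun x _ => ?_) hη.le
    by_cases hx : ∃ t, p (x.1 t, x.2 t) = 0
    · obtain ⟨t, ht⟩ := hx
      rw [iidLaw, Finset.prod_eq_zero (Finset.mem_univ t) ht, zero_mul]
    · push Not at hx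
      rw [Finset.prod_congr rfl fun t _ => h _ ((hp.1 _).lt_of_ne' (hx t))]
      simp

/-- `log (1 + y) ≤ y ^ s / s` for `s ∈ (0, 1]`. -/
theorem log_one_add_le_rpow_div {y s : ℝ} (hy : 0 ≤ y) (hs0 : 0 < s) (hs1 : s ≤ 1) :
    Real.log (1 + y) ≤ y ^ s / s := by
  rw [le_div_iff₀ hs0, mul_comm, ← Real.log_rpow (by linarith)]
  have h1 : (1 + y) ^ s ≤ 1 + y ^ s := by
    simpa using Real.rpow_add_le_add_rpow zero_le_one hy hs0.le hs1
  refine (Real.log_le_log (by positivity) h1).trans ?_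
  have := Real.log_le_sub_one_of_pos (x := 1 + y ^ s) (by positivity)
  linarith

/-- Hashing at a rate `r` such that `r` plus the mean of `log w` is negative. -/
theorem eventually_sum_iidLaw_mul_log_le {A B : Type*} [Fintype A] [Fintype B] {p w : A × B → ℝ}
    (hp : p ∈ stdSimplex ℝ (A × B)) (hw : ∀ z, 0 ≤ w z) (hw' : ∀ z, 0 < p z → 0 < w z)
    {r : ℝ} {m : ℕ → ℝ} (hm : ∀ n : ℕ, 0 ≤ m n) (hm' : ∀ n : ℕ, m n ≤ (2 : ℝ) ^ (n * r))
    (h : ∑ z, p z * Real.log (w z) + r * Real.log 2 < 0 ∨ ∀ n, m n = 0)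
    {η : ℝ} (hη : 0 < η) :
    ∀ᶠ n in atTop,
      ∑ x, iidLaw p n x * Real.log (1 + m n * ∏ t, w (x.1 t, x.2 t)) ≤ η := by
  rcases h with h | h
  · rw [← sum_mul_log_mul_rpow hp hw'] at h
    obtain ⟨s, hs0, hs1, hs⟩ := tendsto_sum_iidLaw_mul_rpow hp
      (fun z => mul_nonneg (hw z) (by positivity))
      (fun z hz => mul_pos (hw' z hz) (by positivity)) h
    have hs' := hs.div_const s
    rw [zero_div] at hs'
    filter_upwards [hs'.eventually_le_const hη] with n hn
    refine le_trans ?_ hn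
    rw [Finset.sum_div]
    refine Finset.sum_le_sum fun x _ => ?_
    rw [mul_div_assoc]
    refine mul_le_mul_of_nonneg_left ?_ ((iidLaw_mem_stdSimplex hp n).1 x)
    rw [prod_mul_rpow_two]
    have hW : 0 ≤ ∏ t, w (x.1 t, x.2 t) := Finset.prod_nonneg fun _ _ => hw _
    refine (log_one_add_le_rpow_div (mul_nonneg (hm n) hW) hs0 hs1).trans ?_
    refine div_le_div_of_nonneg_right (Real.rpow_le_rpow (mul_nonneg (hm n) hW) ?_ hs0.le) hs0.le
    rw [mul_comm]
    exact mul_le_mul_of_nonneg_left (hm' n) hW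
  · exact Eventually.of_forall fun n => by simpa [h n] using hη.le

/-! ### Entropies -/

/-- Entropies are in bits while the estimates use natural logarithms; this is the source of the
factors `Real.log 2`. -/
theorem sum_mul_log_one_div {Z : Type*} [Fintype Z] (p : Z → ℝ) :
    ∑ z, p z * Real.log (1 / p z) = entropy p * Real.log 2 := by
  have h2 : Real.log 2 ≠ 0 := (Real.log_pos one_lt_two).ne'
  rw [entropy, neg_mul, Finset.sum_mul, ← Finset.sum_neg_distrib]
  refine Finset.sum_congr rfl fun z _ => ?_
  rw [one_div, Real.log_inv, Real.logb]; field_simp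

theorem sum_mul_log_law {Ω Z : Type*} [Fintype Ω] [Fintype Z] (p : Ω → ℝ) (f : Ω → Z) :
    ∑ z, p z * Real.log (law p f (f z)) = -(entropy (law p f) * Real.log 2) := by
  rw [← sum_law_mul p f fun a => Real.log (law p f a), ← sum_mul_log_one_div,
    ← Finset.sum_neg_distrib]
  simp

theorem sum_mul_log_snd_div {A B : Type*} [Fintype A] [Fintype B] (p : A × B → ℝ) :
    ∑ z, p z * Real.log (law p Prod.snd z.2 / p z) = H₁given₂ p * Real.log 2 := by
  have h2 : Real.log 2 ≠ 0 := (Real.log_pos one_lt_two).ne'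
  rw [H₁given₂, condEntropy, ← Fintype.sum_prod_type' (f := fun u v => p (u, v) *
    Real.logb 2 (p (u, v) / law p Prod.snd v)), neg_mul, Finset.sum_mul, ← Finset.sum_neg_distrib]
  refine Finset.sum_congr rfl fun z _ => ?_
  rw [← inv_div, Real.log_inv, Real.logb]; field_simp

theorem law_comp_equiv {Ω Ω' α : Type*} [Fintype Ω] [Fintype Ω'] (p : Ω → ℝ) (f : Ω → α)
    (e : Ω' ≃ Ω) : law (fun ω => p (e ω)) (fun ω => f (e ω)) = law p f :=
  funext fun a => Equiv.sum_comp e fun ω => if f ω = a then p ω else 0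

theorem sum_mul_log_fst_div {A B : Type*} [Fintype A] [Fintype B] (p : A × B → ℝ) :
    ∑ z, p z * Real.log (law p Prod.fst z.1 / p z) = H₂given₁ p * Real.log 2 := by
  have h := sum_mul_log_snd_div fun y : B × A => p (y.2, y.1)
  rw [H₁given₂] at h
  rw [H₂given₁, ← h, ← Equiv.sum_comp (Equiv.prodComm B A)]
  refine Finset.sum_congr rfl fun z _ => ?_
  rw [← law_comp_equiv p Prod.fst (Equiv.prodComm B A)]
  rfl

theorem log_law_div_nonneg {Ω α : Type*} [Fintype Ω] {p : Ω → ℝ} (hp : ∀ ω, 0 ≤ p ω) (f : Ω → α)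
    (ω : Ω) : 0 ≤ p ω * Real.log (law p f (f ω) / p ω) := by
  rcases (hp ω).eq_or_lt with h0 | h0
  · simp [← h0]
  · exact mul_nonneg h0.le (Real.log_nonneg ((one_le_div h0).2 (le_law hp f ω)))

/-- A vanishing sum of nonnegative terms vanishes termwise. This turns a zero conditional entropy
into the degenerate branch of the binning bound; a constant `f` covers the zero joint entropy. -/
theorem law_div_eq_one {Ω α : Type*} [Fintype Ω] {p : Ω → ℝ} (hp : ∀ ω, 0 ≤ p ω) (f : Ω → α)
    (h : ∑ ω, p ω * Real.log (law p f (f ω) / p ω) = 0) (ω : Ω) (hω : 0 < p ω) :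
    law p f (f ω) / p ω = 1 := by
  have h1 := (Finset.sum_eq_zero_iff_of_nonneg fun ω _ => log_law_div_nonneg hp f ω).1 h ω
    (Finset.mem_univ ω)
  exact Real.eq_one_of_pos_of_log_eq_zero (div_pos (hω.trans_le (le_law hp f ω)) hω)
    ((mul_eq_zero.1 h1).resolve_left hω.ne')

theorem H₁given₂_nonneg {A B : Type*} [Fintype A] [Fintype B] {p : A × B → ℝ}
    (hp : p ∈ stdSimplex ℝ (A × B)) : 0 ≤ H₁given₂ p := by
  refine nonneg_of_mul_nonneg_left ?_ (Real.log_pos one_lt_two)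
  rw [← sum_mul_log_snd_div]
  exact Finset.sum_nonneg fun z _ => log_law_div_nonneg hp.1 Prod.snd z

theorem H₂given₁_nonneg {A B : Type*} [Fintype A] [Fintype B] {p : A × B → ℝ}
    (hp : p ∈ stdSimplex ℝ (A × B)) : 0 ≤ H₂given₁ p := by
  refine nonneg_of_mul_nonneg_left ?_ (Real.log_pos one_lt_two)
  rw [← sum_mul_log_fst_div]
  exact Finset.sum_nonneg fun z _ => log_law_div_nonneg hp.1 Prod.fst z

theorem sum_mul_log_law_div {Ω α : Type*} [Fintype Ω] [Fintype α] {p : Ω → ℝ} (hp : ∀ ω, 0 ≤ p ω)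
    (f : Ω → α) :
    ∑ ω, p ω * Real.log (law p f (f ω) / p ω) =
      entropy p * Real.log 2 - entropy (law p f) * Real.log 2 := by
  rw [sub_eq_add_neg, ← sum_mul_log_law, ← sum_mul_log_one_div, ← Finset.sum_add_distrib]
  refine Finset.sum_congr rfl fun ω _ => ?_
  rcases (hp ω).eq_or_lt with h0 | h0
  · simp [← h0]
  · rw [Real.log_div (h0.trans_le (le_law hp f ω)).ne' h0.ne', one_div, Real.log_inv]; ring

theorem H₁given₂_eq {A B : Type*} [Fintype A] [Fintype B] {p : A × B → ℝ}
    (hp : p ∈ stdSimplex ℝ (A × B)) : H₁given₂ p = entropy p - entropy (marg₂ p) := by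
  refine mul_right_cancel₀ (Real.log_pos one_lt_two).ne' ?_
  rw [← sum_mul_log_snd_div, sum_mul_log_law_div hp.1, sub_mul]; rfl

theorem H₂given₁_eq {A B : Type*} [Fintype A] [Fintype B] {p : A × B → ℝ}
    (hp : p ∈ stdSimplex ℝ (A × B)) : H₂given₁ p = entropy p - entropy (marg₁ p) := by
  refine mul_right_cancel₀ (Real.log_pos one_lt_two).ne' ?_
  rw [← sum_mul_log_fst_div, sum_mul_log_law_div hp.1, sub_mul]; rfl

/-- Subadditivity of entropy. -/
theorem entropy_le_add {A B : Type*} [Fintype A] [Fintype B] {p : A × B → ℝ}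
    (hp : p ∈ stdSimplex ℝ (A × B)) : entropy p ≤ entropy (marg₁ p) + entropy (marg₂ p) := by
  have h2 := Real.log_pos one_lt_two
  refine le_of_mul_le_mul_right ?_ h2
  have e₁ : entropy (marg₁ p) * Real.log 2 = -∑ z, p z * Real.log (law p Prod.fst z.1) := by
    rw [sum_mul_log_law, neg_neg]; rfl
  have e₂ : entropy (marg₂ p) * Real.log 2 = -∑ z, p z * Real.log (law p Prod.snd z.2) := by
    rw [sum_mul_log_law, neg_neg]; rfl
  rw [add_mul, e₁, e₂, ← sum_mul_log_one_div]
  have key : ∑ z, (p z * Real.log (1 / p z) + p z * Real.log (law p Prod.fst z.1) +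
      p z * Real.log (law p Prod.snd z.2)) ≤
      ∑ z : A × B, (law p Prod.fst z.1 * law p Prod.snd z.2 - p z) := by
    refine Finset.sum_le_sum fun z _ => ?_
    rcases (hp.1 z).eq_or_lt with h0 | h0
    · simpa [← h0] using mul_nonneg (law_nonneg hp.1 Prod.fst z.1) (law_nonneg hp.1 Prod.snd z.2)
    · have p1 := h0.trans_le (le_law hp.1 Prod.fst z)
      have p2 := h0.trans_le (le_law hp.1 Prod.snd z)
      have h3 := Real.log_le_sub_one_of_pos (div_pos (mul_pos p1 p2) h0)
      rw [Real.log_div (mul_pos p1 p2).ne' h0.ne', Real.log_mul p1.ne' p2.ne'] at h3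
      have h4 := mul_le_mul_of_nonneg_left h3 h0.le
      rw [mul_sub _ (_ / _), mul_div_cancel₀ _ h0.ne'] at h4
      rw [one_div, Real.log_inv]
      linarith
  have tot : ∑ z : A × B, (law p Prod.fst z.1 * law p Prod.snd z.2 - p z) = 0 := by
    rw [Finset.sum_sub_distrib, Fintype.sum_prod_type, ← Finset.sum_mul_sum, sum_law, sum_law, hp.2]
    norm_num
  rw [tot, Finset.sum_add_distrib, Finset.sum_add_distrib] at key
  linarith

/-! ### One-time pad with a nearly uniform key -/

/-- Gibbs' inequality: the sum is the divergence of `P` from the uniform law. -/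
theorem sum_mul_log_card_mul_nonneg {G : Type*} [Fintype G] {P : G → ℝ}
    (hP : P ∈ stdSimplex ℝ G) : 0 ≤ ∑ s, P s * Real.log (Fintype.card G * P s) := by
  rcases isEmpty_or_nonempty G with hG | hG
  · simp
  have hM : (0 : ℝ) < Fintype.card G := by exact_mod_cast Fintype.card_pos
  have h : ∑ s, (P s - (Fintype.card G : ℝ)⁻¹) ≤ ∑ s, P s * Real.log (Fintype.card G * P s) := by
    refine Finset.sum_le_sum fun s _ => ?_
    rcases (hP.1 s).eq_or_lt with h0 | h0
    · simp [← h0]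
    · have h1 := Real.one_sub_inv_le_log_of_pos (mul_pos hM h0)
      have h2 := mul_le_mul_of_nonneg_left h1 h0.le
      have h3 : P s * (1 - (Fintype.card G * P s)⁻¹) = P s - (Fintype.card G : ℝ)⁻¹ := by
        field_simp
      linarith
  refine le_trans ?_ h
  rw [Finset.sum_sub_distrib, hP.2, Finset.sum_const, Finset.card_univ, nsmul_eq_mul,
    mul_inv_cancel₀ hM.ne', sub_self]

theorem law_pad_apply {K X G : Type*} [Fintype K] [Fintype X] [AddCommGroup G] (q : K → ℝ)
    (p : X → ℝ) (κ : K → G) (φ : X → G) (c : G) (x : X) :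
    law (fun ω : K × X => q ω.1 * p ω.2) (fun ω => (κ ω.1 + φ ω.2, ω.2)) (c, x) =
      p x * law q κ (c - φ x) := by
  simp only [law, Fintype.sum_prod_type, Finset.mul_sum]
  refine Finset.sum_congr rfl fun k _ => ?_
  rw [Finset.sum_eq_single x (fun y _ hy => by simp [hy]) (by simp)]
  simp [eq_sub_iff_add_eq, mul_comm]

/-- Given `x`, the ciphertext is the hashed key translated by `φ x`, and translation preserves
divergence from uniformity. So the information is the divergence of the hashed key minus that of the
ciphertext, and the latter is nonnegative. -/
theorem mutualInfo_pad_le {K X G : Type*} [Fintype K] [Fintype X] [AddCommGroup G] [Fintype G]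
    {q : K → ℝ} {p : X → ℝ} (hq : q ∈ stdSimplex ℝ K) (hp : p ∈ stdSimplex ℝ X) (κ : K → G)
    (φ : X → G) :
    mutualInfo (law (fun ω : K × X => q ω.1 * p ω.2) (fun ω => (κ ω.1 + φ ω.2, ω.2))) *
        Real.log 2 ≤
      ∑ s, law q κ s * Real.log (Fintype.card G * law q κ s) := by
  set J := law (fun ω : K × X => q ω.1 * p ω.2) (fun ω => (κ ω.1 + φ ω.2, ω.2)) with hJ
  set P := law q κ with hP
  have hPs : P ∈ stdSimplex ℝ G := law_mem_stdSimplex hq κ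
  have hJa : ∀ c x, J (c, x) = p x * P (c - φ x) := law_pad_apply q p κ φ
  have hshift : ∀ (g : G → ℝ) (x : X), ∑ c, g (c - φ x) = ∑ s, g s := fun g x =>
    Equiv.sum_comp (Equiv.subRight (φ x)) g
  have hJ0 : ∀ z, 0 ≤ J z := fun z => by
    rw [← Prod.mk.eta (p := z), hJa]; exact mul_nonneg (hp.1 _) (hPs.1 _)
  have hJs : J ∈ stdSimplex ℝ (G × X) := ⟨hJ0, by
    rw [Fintype.sum_prod_type, Finset.sum_comm]
    simp only [hJa, ← Finset.mul_sum, hshift, hPs.2, mul_one, hp.2]⟩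
  have hJ2 : ∀ x, law J Prod.snd x = p x := fun x => by
    rw [law_snd_apply]
    simp only [hJa, ← Finset.mul_sum, hshift, hPs.2, mul_one]
  have h2 : Real.log 2 ≠ 0 := (Real.log_pos one_lt_two).ne'
  have hG : (0 : ℝ) < Fintype.card G := by exact_mod_cast Fintype.card_pos
  have split : mutualInfo J * Real.log 2 =
      ∑ x, p x * ∑ c, P (c - φ x) * Real.log (Fintype.card G * P (c - φ x)) -
        ∑ c, law J Prod.fst c * Real.log (Fintype.card G * law J Prod.fst c) := by
    rw [sum_law_mul, Fintype.sum_prod_type, mutualInfo, Finset.sum_mul]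
    simp only [Finset.mul_sum]
    rw [Finset.sum_comm (γ := X), ← Finset.sum_sub_distrib]
    refine Finset.sum_congr rfl fun c _ => ?_
    rw [Finset.sum_mul, ← Finset.sum_sub_distrib]
    refine Finset.sum_congr rfl fun x _ => ?_
    rcases (hJ0 (c, x)).eq_or_lt with h0 | h0
    · rw [← mul_assoc, ← hJa, ← h0]; simp
    · have hc := h0.trans_le (le_law hJ0 Prod.fst (c, x))
      have hx := h0.trans_le (le_law hJ0 Prod.snd (c, x))
      rw [hJ2] at hx ⊢
      have hPc : 0 < P (c - φ x) := by
        rw [hJa] at h0; exact pos_of_mul_pos_right h0 hx.le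
      rw [← mul_assoc (p x), ← hJa, mul_assoc, Real.logb, div_mul_cancel₀ _ h2, ← mul_sub]
      congr 1
      rw [Real.log_mul hG.ne' hPc.ne', Real.log_mul hG.ne' hc.ne',
        Real.log_div h0.ne' (mul_pos hc hx).ne', Real.log_mul hc.ne' hx.ne', hJa,
        Real.log_mul hx.ne' hPc.ne']
      ring
  have h3 := sum_mul_log_card_mul_nonneg (law_mem_stdSimplex hJs Prod.fst)
  rw [split]
  simp only [hshift fun s => P s * Real.log (Fintype.card G * P s)]
  rw [← Finset.sum_mul, hp.2, one_mul]
  linarith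

/-! ### The encryption system -/

theorem exists_encSystem {A B : Type*} [Fintype A] [Fintype B] {pX pK : A × B → ℝ}
    (hpX : pX ∈ stdSimplex ℝ (A × B)) (hpK : pK ∈ stdSimplex ℝ (A × B)) (n m₁ m₂ : ℕ)
    (hm₁ : 0 < m₁) (hm₂ : 0 < m₂) :
    ∃ (E : EncSystem A B n) (S : SourceCode A B n), E.Realizes S ∧ E.c₁ = m₁ ∧ E.c₂ = m₂ ∧
      S.errorProb pX ≤ ∑ x, iidLaw pX n x *
        (min 1 ((law (iidLaw pX n) Prod.snd x.2 / iidLaw pX n x - 1) / m₁) +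
          min 1 ((law (iidLaw pX n) Prod.fst x.1 / iidLaw pX n x - 1) / m₂) +
          min 1 ((1 / iidLaw pX n x - 1) / (m₁ * m₂))) ∧
      E.leakage pX pK * Real.log 2 ≤ ∑ k, iidLaw pK n k *
        Real.log (1 + (m₁ - 1) * law (iidLaw pK n) Prod.fst k.1 +
          (m₂ - 1) * law (iidLaw pK n) Prod.snd k.2 + (m₁ - 1) * (m₂ - 1) * iidLaw pK n k) := by
  have : NeZero m₁ := ⟨hm₁.ne'⟩
  have : NeZero m₂ := ⟨hm₂.ne'⟩
  obtain ⟨φ₁, φ₂, ψ, hψ, herr⟩ := exists_binning_error_le (G := Fin m₁) (H := Fin m₂)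
    (iidLaw_mem_stdSimplex hpX n)
  obtain ⟨κ₁, κ₂, hκ⟩ := exists_hash_divergence_le (G := Fin m₁) (H := Fin m₂)
    (iidLaw_mem_stdSimplex hpK n)
  simp only [Fintype.card_fin] at herr hκ
  have hψ₁ : ∀ x₁ x₂, φ₁ (ψ (φ₁ x₁) (φ₂ x₂)).1 = φ₁ x₁ := fun x₁ x₂ =>
    congrArg Prod.fst (hψ (x₁, x₂))
  have hψ₂ : ∀ x₁ x₂, φ₂ (ψ (φ₁ x₁) (φ₂ x₂)).2 = φ₂ x₂ := fun x₁ x₂ =>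
    congrArg Prod.snd (hψ (x₁, x₂))
  let E : EncSystem A B n :=
    { c₁ := m₁
      c₂ := m₂
      Φ₁ := fun k x => κ₁ k + φ₁ x
      Φ₂ := fun k x => κ₂ k + φ₂ x
      Ψ := fun k₁ k₂ c₁ c₂ => ψ (c₁ - κ₁ k₁) (c₂ - κ₂ k₂)
      consistent₁ := fun k₁ k₂ x₁ x₂ => by simp only [add_sub_cancel_left, hψ₁]
      consistent₂ := fun k₁ k₂ x₁ x₂ => by simp only [add_sub_cancel_left, hψ₂] }
  let S : SourceCode A B n := { m₁ := m₁, m₂ := m₂, φ₁ := φ₁, φ₂ := φ₂, ψ := ψ }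
  refine ⟨E, S, fun k₁ k₂ x₁ x₂ => ?_, rfl, rfl, le_trans (le_of_eq ?_) herr, le_trans ?_ hκ⟩
  · simp only [E, S, add_sub_cancel_left]
  · refine Finset.sum_congr rfl fun x _ => ?_
    have hx : x ∈ S.correctSet ↔ ψ (φ₁ x.1) (φ₂ x.2) = x := Iff.rfl
    by_cases h : ψ (φ₁ x.1) (φ₂ x.2) = x
    · exact (if_pos (hx.2 h)).trans (if_pos h).symm
    · exact (if_neg (mt hx.1 h)).trans (if_neg h).symm
  -- The two pads together form one pad in the product group.
  · refine (mutualInfo_pad_le (iidLaw_mem_stdSimplex hpK n) (iidLaw_mem_stdSimplex hpX n)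
      (Prod.map κ₁ κ₂) (Prod.map φ₁ φ₂)).trans (le_of_eq ?_)
    simp

/-! ### Rates -/

theorem floor_two_rpow {r : ℝ} (hr : 0 ≤ r) (n : ℕ) :
    0 < ⌊(2 : ℝ) ^ (n * r)⌋₊ ∧ (⌊(2 : ℝ) ^ (n * r)⌋₊ : ℝ) ≤ 2 ^ (n * r) ∧
      (2 : ℝ) ^ (n * r) ≤ 2 * ⌊(2 : ℝ) ^ (n * r)⌋₊ := by
  have h1 : (1 : ℝ) ≤ 2 ^ (n * r) := Real.one_le_rpow one_le_two (by positivity)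
  have h2 : 0 < ⌊(2 : ℝ) ^ (n * r)⌋₊ := Nat.floor_pos.2 h1
  have h3 := Nat.lt_floor_add_one ((2 : ℝ) ^ (n * r))
  have h4 : (1 : ℝ) ≤ ⌊(2 : ℝ) ^ (n * r)⌋₊ := by exact_mod_cast h2
  exact ⟨h2, Nat.floor_le (by positivity), by linarith⟩

theorem logb_floor_two_rpow_le {r : ℝ} (hr : 0 ≤ r) (n : ℕ) :
    1 / (n : ℝ) * Real.logb 2 (⌊(2 : ℝ) ^ (n * r)⌋₊ : ℝ) ≤ r := by
  obtain ⟨h1, h2, -⟩ := floor_two_rpow hr n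
  have h3 : Real.logb 2 (⌊(2 : ℝ) ^ (n * r)⌋₊ : ℝ) ≤ n * r := by
    rw [Real.logb_le_iff_le_rpow one_lt_two (by exact_mod_cast h1)]
    exact h2
  -- At `n = 0` the convention `1 / 0 = 0` makes the rate 0.
  rcases n.eq_zero_or_pos with rfl | hn
  · simpa using hr
  · have hn' : (0 : ℝ) < n := by exact_mod_cast hn
    rw [one_div, inv_mul_le_iff₀ hn']
    exact h3

/-- One exponential bound for each Slepian–Wolf error event: only the first string wrong, only the
second, or both. -/
theorem eventually_error_le {A B : Type*} [Fintype A] [Fintype B] {p : A × B → ℝ}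
    (hp : p ∈ stdSimplex ℝ (A × B)) {r₁ r₂ : ℝ} (hr₁ : 0 ≤ r₁) (hr₂ : 0 ≤ r₂)
    (h₁ : H₁given₂ p < r₁ ∨ H₁given₂ p = 0) (h₂ : H₂given₁ p < r₂ ∨ H₂given₁ p = 0)
    (h₁₂ : entropy p < r₁ + r₂ ∨ entropy p = 0) {η : ℝ} (hη : 0 < η) :
    ∀ᶠ n : ℕ in atTop, ∑ x, iidLaw p n x *
        (min 1 ((law (iidLaw p n) Prod.snd x.2 / iidLaw p n x - 1) /
          (⌊(2 : ℝ) ^ (n * r₁)⌋₊ : ℝ)) +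
        min 1 ((law (iidLaw p n) Prod.fst x.1 / iidLaw p n x - 1) /
          (⌊(2 : ℝ) ^ (n * r₂)⌋₊ : ℝ)) +
        min 1 ((1 / iidLaw p n x - 1) /
          ((⌊(2 : ℝ) ^ (n * r₁)⌋₊ : ℝ) * (⌊(2 : ℝ) ^ (n * r₂)⌋₊ : ℝ)))) ≤ η := by
  have hl := Real.log_pos one_lt_two
  have hone : ∀ f : A × B → Unit, law p f = fun _ => 1 := fun f => by
    funext u; simp [law, hp.2]
  have pos₁ : ∀ n : ℕ, (0 : ℝ) < ⌊(2 : ℝ) ^ (n * r₁)⌋₊ := fun n => by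
    exact_mod_cast (floor_two_rpow hr₁ n).1
  have pos₂ : ∀ n : ℕ, (0 : ℝ) < ⌊(2 : ℝ) ^ (n * r₂)⌋₊ := fun n => by
    exact_mod_cast (floor_two_rpow hr₂ n).1
  have e₁ := eventually_sum_iidLaw_mul_min_le hp (w := fun z => law p Prod.snd z.2 / p z)
    (fun z => div_nonneg (law_nonneg hp.1 _ _) (hp.1 z))
    (fun z hz => div_pos (hz.trans_le (le_law hp.1 Prod.snd z)) hz) zero_le_two pos₁
    (fun n => (floor_two_rpow hr₁ n).2.2) (by
      rw [sum_mul_log_snd_div]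
      refine h₁.imp (fun h => mul_lt_mul_of_pos_right h hl) fun h => ?_
      exact law_div_eq_one hp.1 Prod.snd (by rw [sum_mul_log_snd_div, h, zero_mul]))
    (η := η / 3) (by positivity)
  have e₂ := eventually_sum_iidLaw_mul_min_le hp (w := fun z => law p Prod.fst z.1 / p z)
    (fun z => div_nonneg (law_nonneg hp.1 _ _) (hp.1 z))
    (fun z hz => div_pos (hz.trans_le (le_law hp.1 Prod.fst z)) hz) zero_le_two pos₂
    (fun n => (floor_two_rpow hr₂ n).2.2) (by
      rw [sum_mul_log_fst_div]
      refine h₂.imp (fun h => mul_lt_mul_of_pos_right h hl) fun h => ?_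
      exact law_div_eq_one hp.1 Prod.fst (by rw [sum_mul_log_fst_div, h, zero_mul]))
    (η := η / 3) (by positivity)
  have e₃ := eventually_sum_iidLaw_mul_min_le hp (w := fun z => 1 / p z)
    (fun z => div_nonneg zero_le_one (hp.1 z)) (fun z hz => div_pos one_pos hz)
    -- Each floor loses at most a factor 2, hence 4 for the product.
    (show (0 : ℝ) ≤ 4 by norm_num) (fun n => mul_pos (pos₁ n) (pos₂ n)) (r := r₁ + r₂)
    (fun n => by
      rw [mul_add, Real.rpow_add two_pos]
      refine (mul_le_mul (floor_two_rpow hr₁ n).2.2 (floor_two_rpow hr₂ n).2.2 (by positivity)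
        (by positivity)).trans (le_of_eq (by ring))) (by
      rw [sum_mul_log_one_div]
      refine h₁₂.imp (fun h => mul_lt_mul_of_pos_right h hl) fun h => ?_
      have := law_div_eq_one hp.1 (fun _ => ()) (by
        simp only [hone]; rw [sum_mul_log_one_div, h, zero_mul])
      simpa only [hone] using this)
    (η := η / 3) (by positivity)
  filter_upwards [e₁, e₂, e₃] with n g₁ g₂ g₃
  simp only [mul_add, Finset.sum_add_distrib, law_fst_iidLaw, law_snd_iidLaw, one_div]
  simp only [Finset.prod_div_distrib, one_div, Finset.prod_inv_distrib]
    at g₁ g₂ g₃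
  simp only [iidLaw] at g₁ g₂ g₃ ⊢
  linarith

/-- A zero rate means a one-element hash range, so every term with the factor `⌊2 ^ (n r)⌋ - 1`
disappears and its key constraint need not be strict. -/
theorem eventually_leakage_le {A B : Type*} [Fintype A] [Fintype B] {q : A × B → ℝ}
    (hq : q ∈ stdSimplex ℝ (A × B)) {r₁ r₂ : ℝ} (hr₁ : 0 ≤ r₁) (hr₂ : 0 ≤ r₂)
    (h₁ : r₁ < entropy (marg₁ q) ∨ r₁ = 0) (h₂ : r₂ < entropy (marg₂ q) ∨ r₂ = 0)
    (h₁₂ : r₁ + r₂ < entropy q ∨ r₁ = 0 ∨ r₂ = 0) {η : ℝ} (hη : 0 < η) :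
    ∀ᶠ n : ℕ in atTop, ∑ k, iidLaw q n k *
        Real.log (1 + ((⌊(2 : ℝ) ^ (n * r₁)⌋₊ : ℝ) - 1) * law (iidLaw q n) Prod.fst k.1 +
          ((⌊(2 : ℝ) ^ (n * r₂)⌋₊ : ℝ) - 1) * law (iidLaw q n) Prod.snd k.2 +
          ((⌊(2 : ℝ) ^ (n * r₁)⌋₊ : ℝ) - 1) * ((⌊(2 : ℝ) ^ (n * r₂)⌋₊ : ℝ) - 1) * iidLaw q n k) ≤
      η := by
  have hl := Real.log_pos one_lt_two
  have nn : ∀ {r : ℝ}, 0 ≤ r → ∀ n : ℕ, (0 : ℝ) ≤ (⌊(2 : ℝ) ^ (n * r)⌋₊ : ℝ) - 1 :=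
    fun hr n => sub_nonneg.2 (by exact_mod_cast (floor_two_rpow hr n).1)
  have le : ∀ {r : ℝ}, 0 ≤ r → ∀ n : ℕ, (⌊(2 : ℝ) ^ (n * r)⌋₊ : ℝ) - 1 ≤ 2 ^ (n * r) :=
    fun hr n => by linarith [(floor_two_rpow hr n).2.1]
  have zero : ∀ {r : ℝ}, r = 0 → ∀ n : ℕ, (⌊(2 : ℝ) ^ (n * r)⌋₊ : ℝ) - 1 = 0 := fun hr n => by
    simp [hr]
  have e₁ := eventually_sum_iidLaw_mul_log_le hq (w := fun z => law q Prod.fst z.1)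
    (fun z => law_nonneg hq.1 _ _) (fun z hz => hz.trans_le (le_law hq.1 Prod.fst z))
    (nn hr₁) (le hr₁) (by
      rw [sum_mul_log_law q Prod.fst]
      refine h₁.imp (fun h => ?_) zero
      linarith [show r₁ * Real.log 2 < entropy (law q Prod.fst) * Real.log 2 from
        mul_lt_mul_of_pos_right h hl]) (η := η / 3) (by positivity)
  have e₂ := eventually_sum_iidLaw_mul_log_le hq (w := fun z => law q Prod.snd z.2)
    (fun z => law_nonneg hq.1 _ _) (fun z hz => hz.trans_le (le_law hq.1 Prod.snd z))
    (nn hr₂) (le hr₂) (by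
      rw [sum_mul_log_law q Prod.snd]
      refine h₂.imp (fun h => ?_) zero
      linarith [show r₂ * Real.log 2 < entropy (law q Prod.snd) * Real.log 2 from
        mul_lt_mul_of_pos_right h hl]) (η := η / 3) (by positivity)
  have e₃ := eventually_sum_iidLaw_mul_log_le hq (w := q) hq.1 (fun z hz => hz)
    (fun n => mul_nonneg (nn hr₁ n) (nn hr₂ n)) (r := r₁ + r₂)
    (fun n => by
      rw [mul_add, Real.rpow_add two_pos]
      exact mul_le_mul (le hr₁ n) (le hr₂ n) (nn hr₂ n) (by positivity)) (by
      have h0 := sum_mul_log_one_div q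
      simp only [one_div, Real.log_inv, mul_neg, Finset.sum_neg_distrib] at h0
      refine h₁₂.imp (fun h => ?_) ?_
      · linarith [mul_lt_mul_of_pos_right h hl]
      · rintro (h | h) n <;> rw [zero h n] <;> ring) (η := η / 3) (by positivity)
  filter_upwards [e₁, e₂, e₃] with n g₁ g₂ g₃
  refine le_trans ?_ (show η / 3 + η / 3 + η / 3 ≤ η by linarith)
  refine le_trans ?_ (add_le_add (add_le_add g₁ g₂) g₃)
  rw [← Finset.sum_add_distrib, ← Finset.sum_add_distrib]
  refine Finset.sum_le_sum fun k _ => ?_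
  rw [← mul_add, ← mul_add, ← law_fst_iidLaw, ← law_snd_iidLaw]
  have hn := iidLaw_mem_stdSimplex hq n
  refine mul_le_mul_of_nonneg_left ?_ (hn.1 k)
  have u₁ := mul_nonneg (nn hr₁ n) (law_nonneg hn.1 Prod.fst k.1)
  have u₂ := mul_nonneg (nn hr₂ n) (law_nonneg hn.1 Prod.snd k.2)
  have u₃ := mul_nonneg (mul_nonneg (nn hr₁ n) (nn hr₂ n)) (hn.1 k)
  change _ ≤ _ + Real.log (1 + _ * iidLaw q n k)
  generalize ((⌊(2 : ℝ) ^ (n * r₁)⌋₊ : ℝ) - 1) * law (iidLaw q n) Prod.fst k.1 = x₁ at *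
  generalize ((⌊(2 : ℝ) ^ (n * r₂)⌋₊ : ℝ) - 1) * law (iidLaw q n) Prod.snd k.2 = x₂ at *
  generalize ((⌊(2 : ℝ) ^ (n * r₁)⌋₊ : ℝ) - 1) * ((⌊(2 : ℝ) ^ (n * r₂)⌋₊ : ℝ) - 1) *
    iidLaw q n k = x₃ at *
  -- The three terms separate because `1 + x₁ + x₂ + x₃ ≤ (1 + x₁) * (1 + x₂) * (1 + x₃)`.
  rw [← Real.log_mul (by positivity) (by positivity), ← Real.log_mul (by positivity) (by positivity)]
  refine Real.log_le_log (by positivity) ?_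
  nlinarith [mul_nonneg u₁ u₂, mul_nonneg u₁ u₃, mul_nonneg u₂ u₃, mul_nonneg (mul_nonneg u₁ u₂) u₃]

/-- A point of the intersection of the two polygons can be moved, by an arbitrarily small increase
of its coordinates, to one where every constraint is strict or degenerate. -/
theorem exists_strict_rates {a₁ a₂ a₁₂ b₁ b₂ b₁₂ R₁ R₂ γ : ℝ} (ha₁ : 0 ≤ a₁) (ha₂ : 0 ≤ a₂)
    (ha : a₁ + a₂ ≤ a₁₂) (hb : b₁₂ ≤ b₁ + b₂)
    (h₁ : a₁ = b₁ → b₁ = 0) (h₂ : a₂ = b₂ → b₂ = 0) (h₁₂ : a₁₂ = b₁₂ → b₁₂ = 0)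
    (haR₁ : a₁ ≤ R₁) (haR₂ : a₂ ≤ R₂) (haR : a₁₂ ≤ R₁ + R₂)
    (hbR₁ : R₁ ≤ b₁) (hbR₂ : R₂ ≤ b₂) (hbR : R₁ + R₂ ≤ b₁₂) (hγ : 0 < γ) :
    ∃ r₁ r₂ : ℝ, 0 ≤ r₁ ∧ 0 ≤ r₂ ∧ r₁ ≤ R₁ + γ ∧ r₂ ≤ R₂ + γ ∧
      (a₁ < r₁ ∨ a₁ = 0) ∧ (a₂ < r₂ ∨ a₂ = 0) ∧ (a₁₂ < r₁ + r₂ ∨ a₁₂ = 0) ∧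
      (r₁ < b₁ ∨ r₁ = 0) ∧ (r₂ < b₂ ∨ r₂ = 0) ∧ (r₁ + r₂ < b₁₂ ∨ r₁ = 0 ∨ r₂ = 0) := by
  rcases (haR.trans hbR).eq_or_lt with e | l
  · have := h₁₂ e
    exact ⟨0, 0, by grind⟩
  -- Here `a₁ = R₁ = b₁ = 0` and `b₁₂ ≤ b₂`, so only the sum constraint remains for `r₂`, and it has
  -- a gap.
  rcases (haR₁.trans hbR₁).eq_or_lt with e₁ | l₁
  · have := h₁ e₁
    exact ⟨0, min ((a₁₂ + b₁₂) / 2) (R₂ + γ), by grind⟩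
  rcases (haR₂.trans hbR₂).eq_or_lt with e₂ | l₂
  · have := h₂ e₂
    exact ⟨min ((a₁₂ + b₁₂) / 2) (R₁ + γ), 0, by grind⟩
  -- An interior point on the segment from `(b₁, b₂)` to `(a₁, a₂)`: `t` makes its coordinate sum
  -- the midpoint of `a₁₂` and `b₁₂`.
  obtain ⟨x₁, x₂, k₁, k₂, k₃, k₄, k₅, k₆⟩ : ∃ x₁ x₂, a₁ < x₁ ∧ a₂ < x₂ ∧ a₁₂ < x₁ + x₂ ∧
      x₁ < b₁ ∧ x₂ < b₂ ∧ x₁ + x₂ < b₁₂ := by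
    have hD : 0 < b₁ + b₂ - a₁ - a₂ := by linarith
    set t := (b₁ + b₂ - (a₁₂ + b₁₂) / 2) / (b₁ + b₂ - a₁ - a₂) with ht
    have ht0 : 0 < t := div_pos (by linarith) hD
    have ht1 : t < 1 := by rw [ht, div_lt_one hD]; linarith
    have hs : t * (b₁ + b₂ - a₁ - a₂) = b₁ + b₂ - (a₁₂ + b₁₂) / 2 := div_mul_cancel₀ _ hD.ne'
    exact ⟨b₁ - t * (b₁ - a₁), b₂ - t * (b₂ - a₂), by nlinarith, by nlinarith, by linarith,
      by nlinarith, by nlinarith, by linarith⟩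
  -- Moving from `R` towards the interior point by the fraction `γ / d` makes all constraints strict
  -- and raises each coordinate by at most `γ`; the summand `γ` in `d` keeps this fraction at most
  -- 1.
  set d := |x₁ - R₁| + |x₂ - R₂| + γ with hd
  have hd0 : 0 < d := by positivity
  set l := γ / d with hl
  have hl0 : 0 < l := div_pos hγ hd0
  have hl1 : 0 ≤ 1 - l := by
    rw [sub_nonneg, hl, div_le_one hd0]; linarith [abs_nonneg (x₁ - R₁), abs_nonneg (x₂ - R₂)]
  have hld : l * d = γ := div_mul_cancel₀ _ hd0.ne'
  have v₁ : l * (x₁ - R₁) ≤ γ := hld ▸ mul_le_mul_of_nonneg_left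
    (by linarith [le_abs_self (x₁ - R₁), abs_nonneg (x₂ - R₂)]) hl0.le
  have v₂ : l * (x₂ - R₂) ≤ γ := hld ▸ mul_le_mul_of_nonneg_left
    (by linarith [le_abs_self (x₂ - R₂), abs_nonneg (x₁ - R₁)]) hl0.le
  have mix : ∀ {s t : ℝ}, 0 ≤ s → 0 < t → 0 < (1 - l) * s + l * t := fun hs ht =>
    add_pos_of_nonneg_of_pos (mul_nonneg hl1 hs) (mul_pos hl0 ht)
  have w₁ := mix (sub_nonneg.2 haR₁) (sub_pos.2 k₁)
  have w₂ := mix (sub_nonneg.2 haR₂) (sub_pos.2 k₂)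
  have w₃ := mix (sub_nonneg.2 haR) (sub_pos.2 k₃)
  have w₄ := mix (sub_nonneg.2 hbR₁) (sub_pos.2 k₄)
  have w₅ := mix (sub_nonneg.2 hbR₂) (sub_pos.2 k₅)
  have w₆ := mix (sub_nonneg.2 hbR) (sub_pos.2 k₆)
  exact ⟨R₁ + l * (x₁ - R₁), R₂ + l * (x₂ - R₂), by linarith, by linarith, by linarith,
    by linarith, .inl (by linarith), .inl (by linarith), .inl (by linarith), .inl (by linarith),
    .inl (by linarith), .inl (by linarith)⟩

/-! ### Diagonal sequences and the theorem -/

/-- At each `n`, take an element for the smallest attainable tolerance among `1 / (k + 1)`, `k ≤ n`;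
by monotonicity it serves all larger ones. -/
theorem exists_diagonal {T : ℕ → Type*} [∀ n, Nonempty (T n)] {P : ∀ n, T n → ℝ → Prop}
    (mono : ∀ n e γ γ', γ ≤ γ' → P n e γ → P n e γ')
    (h : ∀ γ > 0, ∀ᶠ n in atTop, ∃ e, P n e γ) :
    ∃ e : ∀ n, T n, ∀ γ > 0, ∀ᶠ n in atTop, P n (e n) γ := by
  have pick : ∀ n N : ℕ, ∃ e : T n, ∀ k ≤ N, (∃ e', P n e' (1 / (k + 1 : ℝ))) →
      P n e (1 / (k + 1 : ℝ)) := by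
    intro n N
    induction N with
    | zero =>
      by_cases h0 : ∃ e', P n e' (1 / ((0 : ℕ) + 1 : ℝ))
      · exact ⟨h0.choose, fun k hk _ => by rw [Nat.le_zero.1 hk]; exact h0.choose_spec⟩
      · exact ⟨Classical.arbitrary _, fun k hk h => by rw [Nat.le_zero.1 hk] at h; exact (h0 h).elim⟩
    | succ N ih =>
      by_cases h0 : ∃ e', P n e' (1 / ((N + 1 : ℕ) + 1 : ℝ))
      · obtain ⟨e, he⟩ := h0
        exact ⟨e, fun k hk _ => mono n e _ _
          (one_div_le_one_div_of_le (by positivity) (by exact_mod_cast Nat.succ_le_succ hk)) he⟩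
      · obtain ⟨e, he⟩ := ih
        refine ⟨e, fun k hk h => ?_⟩
        rcases hk.eq_or_lt with rfl | hk
        · exact (h0 h).elim
        · exact he k (Nat.lt_succ_iff.1 hk) h
  choose e he using fun n => pick n n
  refine ⟨e, fun γ hγ => ?_⟩
  obtain ⟨k, hk⟩ := exists_nat_one_div_lt hγ
  filter_upwards [h _ (Nat.one_div_pos_of_nat (n := k)), eventually_ge_atTop k] with n hn hkn
  exact mono n _ _ _ hk.le (he n k hkn hn)

theorem innerRegion_subset_region {A B : Type*} [Fintype A] [Fintype B] {pX pK : A × B → ℝ}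
    (hpX : pX ∈ stdSimplex ℝ (A × B)) (hpK : pK ∈ stdSimplex ℝ (A × B)) (δ₀ : ℝ)
    (h₁ : H₁given₂ pX = entropy (marg₁ pK) → entropy (marg₁ pK) = 0)
    (h₂ : H₂given₁ pX = entropy (marg₂ pK) → entropy (marg₂ pK) = 0)
    (h₁₂ : entropy pX = entropy pK → entropy pK = 0) :
    innerRegion pX pK ⊆ region δ₀ pX pK := by
  rintro R ⟨R', ⟨⟨k₁, k₂, k₁₂⟩, s₁, s₂, s₁₂⟩, hR₁, hR₂⟩
  simp only [region, Set.mem_iInter]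
  rintro ε ⟨hε, -⟩ δ ⟨hδ, -⟩
  have hl := Real.log_pos one_lt_two
  have ha : H₁given₂ pX + H₂given₁ pX ≤ entropy pX := by
    linarith [H₁given₂_eq hpX, H₂given₁_eq hpX, entropy_le_add hpX]
  let T : ℕ → Type _ := fun n => {e : EncSystem A B n × SourceCode A B n // e.1.Realizes e.2}
  have : ∀ n, Nonempty (T n) := fun n => by
    -- One-element ciphertext sets give a default system for the lengths at which no tolerance is
    -- attained.
    obtain ⟨E, S, h, -⟩ := exists_encSystem hpX hpK n 1 1 one_pos one_pos
    exact ⟨⟨(E, S), h⟩⟩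
  obtain ⟨e, he⟩ := exists_diagonal (T := T) (P := fun n e γ =>
      1 / (n : ℝ) * Real.logb 2 (e.1.1.c₁ : ℝ) ≤ R.1 + γ ∧
      1 / (n : ℝ) * Real.logb 2 (e.1.1.c₂ : ℝ) ≤ R.2 + γ ∧
      e.1.2.errorProb pX ≤ ε ∧ e.1.1.leakage pX pK ≤ δ)
    (fun n e γ γ' hγ h => ⟨h.1.trans (by linarith), h.2.1.trans (by linarith), h.2.2⟩) (by
      intro γ hγ
      obtain ⟨r₁, r₂, hr₁, hr₂, le₁, le₂, x₁, x₂, x₁₂, y₁, y₂, y₁₂⟩ :=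
        exists_strict_rates (H₁given₂_nonneg hpX) (H₂given₁_nonneg hpX) ha (entropy_le_add hpK)
          h₁ h₂ h₁₂ s₁ s₂ s₁₂ k₁ k₂ k₁₂ hγ
      filter_upwards [eventually_error_le hpX hr₁ hr₂ x₁ x₂ x₁₂ hε,
        eventually_leakage_le hpK hr₁ hr₂ y₁ y₂ y₁₂ (mul_pos hδ hl)] with n he hk
      obtain ⟨E, S, hES, c₁, c₂, herr, hleak⟩ := exists_encSystem hpX hpK n
        ⌊(2 : ℝ) ^ (n * r₁)⌋₊ ⌊(2 : ℝ) ^ (n * r₂)⌋₊ (floor_two_rpow hr₁ n).1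
        (floor_two_rpow hr₂ n).1
      refine ⟨⟨(E, S), hES⟩, ?_, ?_, herr.trans he, le_of_mul_le_mul_right (hleak.trans hk) hl⟩
      · simp only [c₁]
        exact (logb_floor_two_rpow_le hr₁ n).trans (by linarith)
      · simp only [c₂]
        exact (logb_floor_two_rpow_le hr₂ n).trans (by linarith))
  exact ⟨fun n => (e n).1.1, fun n => (e n).1.2, fun n => (e n).2, fun γ hγ =>
    eventually_atTop.1 (he γ hγ)⟩

end DistEnc

theorem theorem1 {A B : Type*} [Fintype A] [Fintype B] (pX pK : A × B → ℝ)
    (hpX : pX ∈ stdSimplex ℝ (A × B)) (hpK : pK ∈ stdSimplex ℝ (A × B))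
    (δ₀ : ℝ) (hδ₀ : 0 < δ₀) (ε δ : ℝ) (hε : ε ∈ Set.Ioo (0 : ℝ) 1)
    (hδ : δ ∈ Set.Ioc (0 : ℝ) δ₀) :
    ((DistEnc.H₁given₂ pX = DistEnc.entropy (DistEnc.marg₁ pK) →
        DistEnc.entropy (DistEnc.marg₁ pK) = 0) →
      (DistEnc.H₂given₁ pX = DistEnc.entropy (DistEnc.marg₂ pK) →
        DistEnc.entropy (DistEnc.marg₂ pK) = 0) →
      (DistEnc.entropy pX = DistEnc.entropy pK → DistEnc.entropy pK = 0) →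
      DistEnc.innerRegion pX pK ⊆ DistEnc.region δ₀ pX pK) ∧
    DistEnc.region δ₀ pX pK ⊆ DistEnc.regionED ε δ pX pK := by
  refine ⟨fun h₁ h₂ h₁₂ => DistEnc.innerRegion_subset_region hpX hpK δ₀ h₁ h₂ h₁₂, fun R hR => ?_⟩
  simp only [DistEnc.region, Set.mem_iInter] at hR
  exact hR ε hε δ hδ
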